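/- Let $X$ and $Y$ be real Banach spaces, let $\mathcal L(X,Y)$ be the space of bounded linear operators from $X$ to $Y$ with the operator norm, and let $B_Z$, $S_Z$ denote the closed unit ball and the unit sphere of a Banach space $Z$. For $G\in\mathcal L(X,Y)$ with $\|G\|=1$ and $T\in\mathcal L(X,Y)$ put $$\|T\|_G:=\inf_{\delta>0}\ \sup\{\|Tx\| : x\in S_X,\ \|Gx\|>1-\delta\}.$$ The operator $G$ is called generating if $\|G\|=1$ and $\|T\|_G=\|T\|$ for every $T\in\mathcal L(X,Y)$; $\operatorname{Gen}(X,Y)$ denotes the set of all generating operators from $X$ to $Y$. Proposition 4.12. Let $X$ be a real Banach space of finite dimension $n$ such that $$B_{\mathcal L(X,Y)}=\overline{\operatorname{conv}}\bigl(\operatorname{Gen}(X,Y)\bigr)$$ (closure of the convex hull in the operator norm) for every non-zero real Banach space $Y$. Then $X$ is isometrically isomorphic to $\ell_1^n$, that is, to $\mathbb R^n$ with the norm $\|a\|_1=\sum_{i=1}^n|a_i|$. -/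

import Mathlib

universe u

noncomputable section GeneratingOperators

/-- The `δ`-attainment set `att(G, δ) = {x ∈ S_X : ‖G x‖ > 1 - δ}`. -/
def attSet {𝕜 X Y : Type*} [RCLike 𝕜] [NormedAddCommGroup X] [NormedSpace 𝕜 X]
    [NormedAddCommGroup Y] [NormedSpace 𝕜 Y] (G : X →L[𝕜] Y) (δ : ℝ) : Set X :=
  {x | ‖x‖ = 1 ∧ 1 - δ < ‖G x‖}

/-- `‖T‖_{G,δ} = sup {‖T x‖ : x ∈ att(G, δ)}`. The set is bounded above by `‖T‖`, and it is
nonempty whenever `‖G‖ = 1` and `δ > 0`, the only case in which this is used. -/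
def attNorm {𝕜 X Y Z : Type*} [RCLike 𝕜] [NormedAddCommGroup X] [NormedSpace 𝕜 X]
    [NormedAddCommGroup Y] [NormedSpace 𝕜 Y] [NormedAddCommGroup Z] [NormedSpace 𝕜 Z]
    (G : X →L[𝕜] Y) (δ : ℝ) (T : X →L[𝕜] Z) : ℝ :=
  sSup ((fun x => ‖T x‖) '' attSet G δ)

/-- The (semi-)norm of `T` relative to `G`: `‖T‖_G = inf_{δ > 0} ‖T‖_{G,δ}`. -/
def relNorm {𝕜 X Y Z : Type*} [RCLike 𝕜] [NormedAddCommGroup X] [NormedSpace 𝕜 X]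
    [NormedAddCommGroup Y] [NormedSpace 𝕜 Y] [NormedAddCommGroup Z] [NormedSpace 𝕜 Z]
    (G : X →L[𝕜] Y) (T : X →L[𝕜] Z) : ℝ :=
  sInf ((fun δ => attNorm G δ T) '' Set.Ioi (0 : ℝ))

/-- `Gen(X, Y)`: the norm-one operators `G` with `‖T‖_G = ‖T‖` for every bounded linear
`T : X → Y`. -/
def Gen (𝕜 X Y : Type*) [RCLike 𝕜] [NormedAddCommGroup X] [NormedSpace 𝕜 X]
    [NormedAddCommGroup Y] [NormedSpace 𝕜 Y] : Set (X →L[𝕜] Y) :=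
  {G | ‖G‖ = 1 ∧ ∀ T : X →L[𝕜] Y, relNorm G T = ‖T‖}

end GeneratingOperators

/-! A generating operator has norm one at every extreme point of `B_X`. For finite-dimensional `Y`,
compactness then makes every contraction a genuine convex combination of contractions with this
property (`mem_convexHull_extIsometric`). With `Y` a line, this leaves only finitely many extreme
points (`finite_ballExt_of_line`). With `Y` Hilbert of dimension `n`, take a contraction `T` with
kernel `ℝe₀`, `e₀` extreme, whose contact points span as much as possible; together with `e₀` they
span `X`. Strict convexity makes the operators averaging to `T` agree with it there, and perturbing
`T` shows that every extreme point other than `±e₀` lies in the contact span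
(`exists_functional_of_ballExt`). So the extreme points are `±` a basis, and the ball is a
cross-polytope. -/

/-- In a finite-dimensional space the convex hull of a compact set is compact. -/
theorem isCompact_convexHull_of_finiteDimensional {E : Type*} [NormedAddCommGroup E]
    [NormedSpace ℝ E] [FiniteDimensional ℝ E] {s : Set E} (hs : IsCompact s) :
    IsCompact (convexHull ℝ s) := by
  -- Carathéodory: at most `finrank + 1` points are needed, so the hull is a finite union of
  -- continuous images of compact sets.
  have key : convexHull ℝ s = ⋃ k ∈ Finset.range (Module.finrank ℝ E + 2),
      (fun p : (Fin k → ℝ) × (Fin k → E) => ∑ i, p.1 i • p.2 i) ''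
        (stdSimplex ℝ (Fin k) ×ˢ Set.univ.pi fun _ => s) := by
    ext x
    simp only [Set.mem_iUnion, Set.mem_image, Prod.exists, Set.mem_prod, Set.mem_univ_pi]
    constructor
    · intro hx
      obtain ⟨ι, _, z, w, hz, hind, hw, hw1, rfl⟩ := eq_pos_convex_span_of_mem_convexHull hx
      refine ⟨Fintype.card ι, ?_, w ∘ (Fintype.equivFin ι).symm, z ∘ (Fintype.equivFin ι).symm,
        ⟨⟨fun i => (hw _).le, ?_⟩, fun i => hz ⟨_, rfl⟩⟩, ?_⟩
      · have := hind.card_le_finrank_succ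
        have h2 := Submodule.finrank_le (vectorSpan ℝ (Set.range z))
        rw [Finset.mem_range]
        omega
      · rw [← hw1]
        exact Equiv.sum_comp (Fintype.equivFin ι).symm w
      · exact Equiv.sum_comp (Fintype.equivFin ι).symm fun i => w i • z i
    · rintro ⟨k, -, w, z, ⟨⟨hw, hw1⟩, hz⟩, rfl⟩
      exact (convex_convexHull ℝ s).sum_mem (fun i _ => hw i) hw1
        fun i _ => subset_convexHull ℝ s (hz i)
  rw [key]
  refine Finset.isCompact_biUnion _ fun k _ => ?_
  refine ((isCompact_stdSimplex ℝ (Fin k)).prod (isCompact_univ_pi fun _ => hs)).image ?_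
  fun_prop

/-! ### Extreme points of the unit ball. -/

section Operators

variable {X Y : Type*} [NormedAddCommGroup X] [NormedSpace ℝ X]
  [NormedAddCommGroup Y] [NormedSpace ℝ Y]

/-- The extreme points of the closed unit ball. -/
abbrev ballExt (X : Type*) [NormedAddCommGroup X] [NormedSpace ℝ X] : Set X :=
  (Metric.closedBall (0 : X) 1).extremePoints ℝ

theorem norm_eq_one_of_mem_ballExt [Nontrivial X] {e : X} (he : e ∈ ballExt X) : ‖e‖ = 1 := by
  have h1 : ‖e‖ ≤ 1 := by simpa using he.1
  by_contra hne
  have hlt : ‖e‖ < 1 := lt_of_le_of_ne h1 hne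
  obtain ⟨v, hv⟩ := exists_norm_eq X (sub_pos.2 hlt).le
  have hmem : e ∈ openSegment ℝ (e + v) (e - v) :=
    ⟨1/2, 1/2, by norm_num, by norm_num, by norm_num, by module⟩
  have := he.2 (x₁ := e + v) (by simpa using (norm_add_le e v).trans (by linarith))
    (x₂ := e - v) (by simpa using (norm_sub_le e v).trans (by linarith)) hmem
  have hv0 : v = 0 := by simpa using this
  rw [hv0, norm_zero] at hv
  linarith

variable [FiniteDimensional ℝ X]

theorem closedBall_eq_closure_convexHull_ballExt :
    closure (convexHull ℝ (ballExt X)) = Metric.closedBall (0 : X) 1 := by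
  have := FiniteDimensional.proper_real X
  exact closure_convexHull_extremePoints (isCompact_closedBall _ _) (convex_closedBall _ _)

/-- The norm of an operator is controlled by its values at the extreme points of the ball. -/
theorem opNorm_le_one_of_ballExt {T : X →L[ℝ] Y} (h : ∀ e ∈ ballExt X, ‖T e‖ ≤ 1) : ‖T‖ ≤ 1 := by
  refine ContinuousLinearMap.opNorm_le_of_unit_norm zero_le_one fun x hx => ?_
  have hsub : closure (convexHull ℝ (ballExt X)) ⊆ T ⁻¹' Metric.closedBall 0 1 := by
    refine closure_minimal (convexHull_min (fun e he => by simpa using h e he) ?_)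
      (Metric.isClosed_closedBall.preimage T.continuous)
    exact (convex_closedBall _ _).linear_preimage (T : X →ₗ[ℝ] Y)
  rw [closedBall_eq_closure_convexHull_ballExt] at hsub
  simpa using hsub (a := x) (by simp [hx])

theorem span_ballExt : Submodule.span ℝ (ballExt X) = ⊤ := by
  have hsub : closure (convexHull ℝ (ballExt X)) ⊆ Submodule.span ℝ (ballExt X) :=
    closure_minimal (convexHull_min Submodule.subset_span (Submodule.convex _))
      (Submodule.closed_of_finiteDimensional _)
  rw [closedBall_eq_closure_convexHull_ballExt] at hsub
  refine eq_top_iff.2 fun x _ => ?_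
  by_cases hx : x = 0
  · simp [hx]
  have h1 : ‖x‖⁻¹ • x ∈ Submodule.span ℝ (ballExt X) := hsub (by simp [norm_smul, hx])
  have h2 := Submodule.smul_mem _ ‖x‖ h1
  rwa [smul_smul, mul_inv_cancel₀ (norm_ne_zero_iff.2 hx), one_smul] at h2

end Operators

open Filter Topology

/-! ### Generating operators at extreme points, and operators into a line. -/

section Generating

variable {X Y : Type*} [NormedAddCommGroup X] [NormedSpace ℝ X]
  [NormedAddCommGroup Y] [NormedSpace ℝ Y]

theorem Gen.norm_le_attNorm {G : X →L[ℝ] Y} (hG : G ∈ Gen ℝ X Y) (T : X →L[ℝ] Y) {δ : ℝ}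
    (hδ : 0 < δ) : ‖T‖ ≤ attNorm G δ T := by
  rw [← hG.2 T]
  refine csInf_le ⟨0, ?_⟩ ⟨δ, hδ, rfl⟩
  rintro _ ⟨δ', -, rfl⟩
  refine Real.sSup_nonneg ?_
  rintro _ ⟨x, -, rfl⟩
  exact norm_nonneg _

theorem Gen.attSet_nonempty {G : X →L[ℝ] Y} (hG : G ∈ Gen ℝ X Y) {δ : ℝ} (hδ : 0 < δ) :
    (attSet G δ).Nonempty := by
  by_contra h
  have h1 := Gen.norm_le_attNorm hG G hδ
  -- An empty attainment set would give `sSup ∅ = 0`, against `‖G‖ = 1`.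
  rw [attNorm, Set.not_nonempty_iff_eq_empty.1 h, Set.image_empty, Real.sSup_empty, hG.1] at h1
  linarith

variable [FiniteDimensional ℝ X]

/-- Every functional attains its norm at a point where the generating operator does. -/
theorem Gen.exists_attains [Nontrivial Y] {G : X →L[ℝ] Y} (hG : G ∈ Gen ℝ X Y)
    (f : StrongDual ℝ X) : ∃ x : X, ‖x‖ = 1 ∧ ‖G x‖ = 1 ∧ ‖f‖ ≤ |f x| := by
  have := FiniteDimensional.proper_real X
  obtain ⟨y, hy⟩ := exists_norm_eq Y zero_le_one
  -- Rank-one operators turn the condition on `G` into one on functionals; a limit of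
  -- near-maximizers for `δ = 1/(k+1)` is the required point.
  have hT : ‖f.smulRight y‖ = ‖f‖ := by simp [hy]
  have key : ∀ k : ℕ, ∃ x : X, (‖x‖ = 1 ∧ 1 - 1 / ((k : ℝ) + 1) < ‖G x‖) ∧
      ‖f‖ - 1 / ((k : ℝ) + 1) < |f x| := by
    intro k
    have hk : (0 : ℝ) < 1 / ((k : ℝ) + 1) := by positivity
    have h1 := Gen.norm_le_attNorm hG (f.smulRight y) hk
    rw [hT] at h1
    obtain ⟨_, ⟨x, hx, rfl⟩, hlt⟩ :=
      exists_lt_of_lt_csSup ((Gen.attSet_nonempty hG hk).image _)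
        (lt_of_lt_of_le (sub_lt_self _ hk) h1)
    exact ⟨x, hx, by simpa [norm_smul, hy] using hlt⟩
  choose x hx hfx using key
  obtain ⟨a, ha, φ, hφ, hlim⟩ := (isCompact_sphere (0 : X) 1).tendsto_subseq
    (x := x) fun k => by simpa using (hx k).1
  have hδ : Tendsto (fun k : ℕ => 1 / ((φ k : ℝ) + 1)) atTop (𝓝 0) :=
    tendsto_one_div_add_atTop_nhds_zero_nat.comp hφ.tendsto_atTop
  have ha1 : ‖a‖ = 1 := by simpa using ha
  refine ⟨a, ha1, le_antisymm ?_ ?_, ?_⟩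
  · simpa [hG.1, ha1] using G.le_opNorm a
  · have h1 : Tendsto (fun k : ℕ => 1 - 1 / ((φ k : ℝ) + 1)) atTop (𝓝 (1 - 0)) :=
      hδ.const_sub 1
    rw [sub_zero] at h1
    exact le_of_tendsto_of_tendsto' h1 ((G.continuous.tendsto a).norm.comp hlim)
      fun k => (hx (φ k)).2.le
  · have h1 : Tendsto (fun k : ℕ => ‖f‖ - 1 / ((φ k : ℝ) + 1)) atTop (𝓝 (‖f‖ - 0)) :=
      hδ.const_sub _
    rw [sub_zero] at h1
    exact le_of_tendsto_of_tendsto' h1 ((f.continuous.tendsto a).abs.comp hlim)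
      fun k => (hfx (φ k)).le

/-- A generating operator on a finite-dimensional space preserves the norm of the extreme points. -/
theorem Gen.norm_apply_ballExt [Nontrivial Y] {G : X →L[ℝ] Y} (hG : G ∈ Gen ℝ X Y)
    {e : X} (he : e ∈ ballExt X) : ‖G e‖ = 1 := by
  have := FiniteDimensional.proper_real X
  set A : Set X := {x | ‖x‖ = 1 ∧ ‖G x‖ = 1} with hA
  have hAc : IsCompact A := by
    refine (isCompact_sphere (0 : X) 1).of_isClosed_subset ?_ fun x hx => by simpa using hx.1
    exact (isClosed_eq continuous_norm continuous_const).inter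
      (isClosed_eq G.continuous.norm continuous_const)
  have hconv := isCompact_convexHull_of_finiteDimensional hAc
  have hAneg : ∀ x ∈ A, -x ∈ A := fun x hx => by simpa [hA] using hx
  -- A functional separating `e` from the symmetric set `A` would satisfy `|f| < f e ≤ ‖f‖` on `A`,
  -- so it could not attain its norm there.
  have hmem : e ∈ convexHull ℝ A := by
    by_contra hne
    obtain ⟨f, u, hu, hue⟩ :=
      geometric_hahn_banach_closed_point (convex_convexHull ℝ A) hconv.isClosed hne
    obtain ⟨x, hx, hGx, hfx⟩ := Gen.exists_attains hG f
    have h1 := hu x (subset_convexHull ℝ A ⟨hx, hGx⟩)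
    have h2 := hu (-x) (subset_convexHull ℝ A (hAneg x ⟨hx, hGx⟩))
    rw [map_neg] at h2
    have h3 : |f x| < u := abs_lt.2 ⟨by linarith, h1⟩
    have h4 : f e ≤ ‖f‖ := by
      have he1 : ‖e‖ ≤ 1 := by simpa using he.1
      calc f e ≤ ‖f e‖ := le_abs_self _
        _ ≤ ‖f‖ * ‖e‖ := f.le_opNorm e
        _ ≤ ‖f‖ := mul_le_of_le_one_right (norm_nonneg _) he1
    linarith
  have hsub : convexHull ℝ A ⊆ Metric.closedBall 0 1 :=
    convexHull_min (fun x hx => by simp [hx.1]) (convex_closedBall _ _)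
  -- Being extreme in the ball, `e` is extreme in the smaller hull, hence belongs to `A`.
  exact (extremePoints_convexHull_subset
    (inter_extremePoints_subset_extremePoints_of_subset hsub ⟨hmem, he⟩)).2

/-- The contractions that preserve the norm of the extreme points of the ball. -/
def extIsometric (X Y : Type*) [NormedAddCommGroup X] [NormedSpace ℝ X]
    [NormedAddCommGroup Y] [NormedSpace ℝ Y] : Set (X →L[ℝ] Y) :=
  {G | ‖G‖ ≤ 1 ∧ ∀ e ∈ ballExt X, ‖G e‖ = 1}

theorem isCompact_extIsometric [FiniteDimensional ℝ Y] : IsCompact (extIsometric X Y) := by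
  have : ProperSpace (X →L[ℝ] Y) := FiniteDimensional.proper_real _
  refine (isCompact_closedBall (0 : X →L[ℝ] Y) 1).of_isClosed_subset ?_
    fun G hG => by simpa using hG.1
  have : extIsometric X Y = {G | ‖G‖ ≤ 1} ∩ ⋂ e ∈ ballExt X, {G | ‖G e‖ = 1} := by
    ext; simp [extIsometric]
  rw [this]
  refine (isClosed_le continuous_norm continuous_const).inter (isClosed_biInter fun e _ => ?_)
  exact isClosed_eq (by fun_prop) continuous_const

/-- The hull of `extIsometric` is compact, so the closure disappears and finite convex
decompositions become available. -/
theorem mem_convexHull_extIsometric [FiniteDimensional ℝ Y] [Nontrivial Y]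
    (h : Metric.closedBall (0 : X →L[ℝ] Y) 1 = closure (convexHull ℝ (Gen ℝ X Y)))
    {T : X →L[ℝ] Y} (hT : ‖T‖ ≤ 1) : T ∈ convexHull ℝ (extIsometric X Y) := by
  have hsub : Gen ℝ X Y ⊆ extIsometric X Y :=
    fun G hG => ⟨hG.1.le, fun e he => Gen.norm_apply_ballExt hG he⟩
  have h1 : T ∈ closure (convexHull ℝ (Gen ℝ X Y)) := by rw [← h]; simpa using hT
  exact closure_minimal (convexHull_mono hsub)
    (isCompact_convexHull_of_finiteDimensional isCompact_extIsometric).isClosed h1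

/-- If contractions into a line are convex combinations of operators preserving the norm of the
extreme points, then there are finitely many extreme points. -/
theorem finite_ballExt_of_line [Nontrivial Y] [FiniteDimensional ℝ Y]
    (hY : (Metric.sphere (0 : Y) 1).Finite)
    (h : ∀ T : X →L[ℝ] Y, ‖T‖ ≤ 1 → T ∈ convexHull ℝ (extIsometric X Y)) :
    (ballExt X).Finite := by
  have hspan : Submodule.span ℝ (extIsometric X Y) = ⊤ := by
    refine eq_top_iff.2 fun T _ => ?_
    have hc : convexHull ℝ (extIsometric X Y) ⊆ Submodule.span ℝ (extIsometric X Y) :=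
      convexHull_min Submodule.subset_span (Submodule.convex _)
    by_cases hT : T = 0
    · simp [hT]
    have h1 := Submodule.smul_mem _ ‖T‖ (hc (h (‖T‖⁻¹ • T) (by simp [norm_smul, hT])))
    rwa [smul_smul, mul_inv_cancel₀ (norm_ne_zero_iff.2 hT), one_smul] at h1
  -- Finitely many of these operators span all operators, so their values, taken in a finite sphere,
  -- determine an extreme point.
  obtain ⟨S, hS, -, hSspan, -⟩ := Submodule.exists_finset_span_eq_linearIndepOn ℝ (extIsometric X Y)
  rw [hspan] at hSspan
  refine Set.Finite.of_injOn (f := fun (e : X) (G : S) => (G : X →L[ℝ] Y) e)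
    (t := Set.univ.pi fun _ => Metric.sphere (0 : Y) 1) ?_ ?_ (Set.Finite.pi fun _ => hY)
  · intro e he G _
    simpa using (hS G.2).2 e he
  · intro e _ e' _ hee
    obtain ⟨y, hy⟩ := exists_ne (0 : Y)
    have hall : ∀ T : X →L[ℝ] Y, T e = T e' := by
      intro T
      have hT : T ∈ Submodule.span ℝ (S : Set (X →L[ℝ] Y)) := by simp [hSspan]
      induction hT using Submodule.span_induction with
      | mem G hG => exact congrFun hee ⟨G, hG⟩
      | zero => rfl
      | add _ _ _ _ h1 h2 => simp [h1, h2]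
      | smul _ _ _ h1 => simp [h1]
    by_contra hne
    obtain ⟨f, hf⟩ := SeparatingDual.exists_separating_of_ne (R := ℝ) hne
    exact hf (smul_left_injective ℝ hy (by simpa using hall (f.smulRight y)))

end Generating

/-! ### Contractions into a Hilbert space and their contact points. -/

section Hilbert

variable {X H : Type*} [NormedAddCommGroup X] [NormedSpace ℝ X]
  [NormedAddCommGroup H] [InnerProductSpace ℝ H]

/-- The extreme points of the ball at which a contraction attains norm one. -/
def contactSet (T : X →L[ℝ] H) : Set X := {e | e ∈ ballExt X ∧ ‖T e‖ = 1}

/-- By strict convexity, the operators of a convex decomposition of `T` agree with `T` at its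
contact points. -/
theorem norm_sq_of_mem_convexHull {T : X →L[ℝ] H} (hT : T ∈ convexHull ℝ (extIsometric X H))
    {e₀ u : X} (he₀ : e₀ ∈ ballExt X) {a : ℝ} (he : a • e₀ + u ∈ ballExt X)
    (hu : u ∈ Submodule.span ℝ (contactSet T)) :
    1 = a ^ 2 + 2 * a * inner ℝ (T e₀) (T u) + ‖T u‖ ^ 2 := by
  obtain ⟨ι, _, w, G, hw, hw1, hG, hTG⟩ := mem_convexHull_iff_exists_fintype.1 hT
  have happ : ∀ x, T x = ∑ i, w i • G i x := fun x => by simp [← hTG]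
  -- The inner products `⟨G j c, T c⟩ ≤ 1` average to `‖T c‖² = 1`, so those of non-zero weight
  -- equal 1: equality in Cauchy–Schwarz.
  have hcontact : ∀ i, w i ≠ 0 → ∀ c ∈ contactSet T, G i c = T c := by
    intro i hi c hc
    have hle : ∀ j, inner ℝ (G j c) (T c) ≤ 1 := fun j => by
      simpa [(hG j).2 c hc.1, hc.2] using real_inner_le_norm (G j c) (T c)
    have hsum : ∑ j, w j * (1 - inner ℝ (G j c) (T c)) = 0 := by
      have h1 : inner ℝ (T c) (T c) = ∑ j, w j * inner ℝ (G j c) (T c) := by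
        conv_lhs => rw [happ c, sum_inner]
        simp only [real_inner_smul_left, ← happ c]
      rw [real_inner_self_eq_norm_sq, hc.2] at h1
      simp only [mul_sub, mul_one, Finset.sum_sub_distrib, hw1, ← h1]
      norm_num
    have h2 := (Finset.sum_eq_zero_iff_of_nonneg fun j _ =>
      mul_nonneg (hw j) (sub_nonneg.2 (hle j))).1 hsum i (Finset.mem_univ i)
    have h3 : inner ℝ (G i c) (T c) = 1 := by
      rcases mul_eq_zero.1 h2 with h | h
      · exact absurd h hi
      · linarith
    exact (inner_eq_one_iff_of_norm_eq_one ((hG i).2 c hc.1) hc.2).1 h3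
  have hspan : ∀ i, w i ≠ 0 → G i u = T u := by
    intro i hi
    clear he
    induction hu using Submodule.span_induction with
    | mem c hc => exact hcontact i hi c hc
    | zero => simp
    | add _ _ _ _ h1 h2 => simp [h1, h2]
    | smul _ _ _ h1 => simp [h1]
  -- Expanding `‖G i (a • e₀ + u)‖² = 1` leaves a term linear in `G i e₀`, which averages to `T e₀`.
  have hterm : ∀ i, w i * 1 = w i * a ^ 2 + 2 * a * inner ℝ (w i • G i e₀) (T u)
      + w i * ‖T u‖ ^ 2 := by
    intro i
    by_cases hi : w i = 0
    · simp [hi]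
    have h1 := (hG i).2 _ he
    have h2 := norm_add_sq_real (a • G i e₀) (T u)
    rw [map_add, map_smul, hspan i hi] at h1
    rw [h1, norm_smul, (hG i).2 e₀ he₀, real_inner_smul_left, mul_one, Real.norm_eq_abs,
      sq_abs] at h2
    rw [real_inner_smul_left]
    linear_combination w i * h2
  have hfinal := Finset.sum_congr (rfl : (Finset.univ : Finset ι) = _) fun i _ => hterm i
  simpa only [Finset.sum_add_distrib, ← Finset.sum_mul, ← Finset.mul_sum, hw1, one_mul,
    ← sum_inner, ← happ e₀] using hfinal

variable [FiniteDimensional ℝ X]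

/-- A contraction with kernel spanned by an extreme point `e₀`, whose contact points span a
complement of `e₀`, produces a functional vanishing at the extreme points other than `± e₀`. -/
theorem exists_functional_of_contactSet (hfin : (ballExt X).Finite)
    (hH : ∀ T : X →L[ℝ] H, ‖T‖ ≤ 1 → T ∈ convexHull ℝ (extIsometric X H))
    {e₀ : X} (he₀ : e₀ ∈ ballExt X) {T : X →L[ℝ] H} (hT : ‖T‖ ≤ 1)
    (hker : ∀ x, T x = 0 ↔ x ∈ Submodule.span ℝ {e₀})
    (hspan : Submodule.span ℝ (contactSet T) ⊔ Submodule.span ℝ {e₀} = ⊤) :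
    ∃ φ : X →ₗ[ℝ] ℝ, φ e₀ = 1 ∧ ∀ e ∈ ballExt X, e ≠ e₀ → e ≠ -e₀ → φ e = 0 := by
  have hTe₀ : T e₀ = 0 := (hker e₀).2 (Submodule.mem_span_singleton_self e₀)
  have hnot : e₀ ∉ Submodule.span ℝ (contactSet T) := fun h => by
    simpa [hTe₀] using norm_sq_of_mem_convexHull (hH T hT) he₀ (a := 0) (u := e₀) (by simpa) h
  obtain ⟨φ, hφ, hφe₀⟩ := LinearMap.exists_extend_of_notMem
    (0 : Submodule.span ℝ (contactSet T) →ₗ[ℝ] ℝ) hnot 1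
  have hφ0 : ∀ x ∈ Submodule.span ℝ (contactSet T), φ x = 0 :=
    fun x hx => congrArg (fun g => g ⟨x, hx⟩) hφ
  refine ⟨φ, hφe₀, fun e he hne hne' => ?_⟩
  obtain ⟨u, hu, z, hz, rfl⟩ := Submodule.mem_sup.1 (hspan ▸ Submodule.mem_top : e ∈ _)
  obtain ⟨a, rfl⟩ := Submodule.mem_span_singleton.1 hz
  rw [add_comm u] at he hne hne'
  have hφa : φ (u + a • e₀) = a := by simp [hφ0 u hu, hφe₀]
  rw [hφa]
  by_contra ha
  have h0 := norm_sq_of_mem_convexHull (hH T hT) he₀ he hu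
  -- The perturbation sends `e₀` to `t • T u` and fixes `T` on its contact points. The other extreme
  -- points, finite in number, have slack, so small `t` keeps a contraction.
  let S : ℝ → X →L[ℝ] H := fun t =>
    T + t • (LinearMap.toContinuousLinearMap φ).smulRight (T u)
  have hSapp : ∀ t x, S t x = T x + t • φ x • T u := fun t x => by simp [S]
  have hev : ∀ᶠ t in 𝓝 (0 : ℝ), ∀ e ∈ ballExt X, ‖S t e‖ ≤ 1 := by
    refine (eventually_all_finite hfin).2 fun e he => ?_
    have hTe : ‖T e‖ ≤ 1 := by
      have he1 : ‖e‖ ≤ 1 := by simpa using he.1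
      exact (T.le_opNorm e).trans (mul_le_one₀ hT (norm_nonneg _) he1)
    rcases hTe.lt_or_eq with hlt | heq
    · have hc : Continuous fun t => ‖S t e‖ := by simp only [hSapp]; fun_prop
      have := hc.tendsto 0
      rw [hSapp, zero_smul, add_zero] at this
      exact (this.eventually (gt_mem_nhds hlt)).mono fun t ht => le_of_lt ht
    · exact Eventually.of_forall fun t => by
        simp [hSapp, hφ0 e (Submodule.subset_span ⟨he, heq⟩), heq]
  obtain ⟨t, ht, htpos⟩ :=
    ((hev.filter_mono nhdsWithin_le_nhds).and (self_mem_nhdsWithin (s := Set.Ioi 0))).exists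
  have hsub : contactSet T ⊆ contactSet (S t) := fun c hc =>
    ⟨hc.1, by rw [hSapp, hφ0 c (Submodule.subset_span hc)]; simpa using hc.2⟩
  have h1 := norm_sq_of_mem_convexHull (hH (S t) (opNorm_le_one_of_ballExt ht)) he₀ he
    (Submodule.span_mono hsub hu)
  simp only [hSapp, hTe₀, hφe₀, hφ0 u hu, zero_add, one_smul, zero_smul, smul_zero, add_zero,
    real_inner_smul_left, real_inner_self_eq_norm_sq] at h1
  rw [hTe₀, inner_zero_left] at h0
  -- The identities for `T` and `S t` differ only in the cross term.
  have h2 : a * t * ‖T u‖ ^ 2 = 0 := by linarith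
  have hTu : T u = 0 := by
    have : t ≠ 0 := ne_of_gt htpos
    simpa [ha, this] using h2
  obtain ⟨c, rfl⟩ := Submodule.mem_span_singleton.1 ((hker u).1 hTu)
  have hc : c = 0 := by
    by_contra hc
    have := Submodule.smul_mem _ c⁻¹ hu
    rw [smul_smul, inv_mul_cancel₀ hc, one_smul] at this
    exact hnot this
  rw [hTu] at h0
  have ha2 : a = 1 ∨ a = -1 := by
    simpa using h0.symm
  rcases ha2 with rfl | rfl <;> simp [hc] at hne hne'

/-- A contraction whose contact points do not span a complement of its kernel can be modified so
as to acquire a new contact point, without enlarging the kernel. -/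
theorem exists_contraction_contactSet_lt (hfin : (ballExt X).Finite) [FiniteDimensional ℝ H]
    {e₀ : X} {T : X →L[ℝ] H} (hT : ‖T‖ ≤ 1)
    (hker : ∀ x, T x = 0 ↔ x ∈ Submodule.span ℝ {e₀})
    (hrange : LinearMap.range (T : X →ₗ[ℝ] H) ≠ ⊤)
    (hspan : Submodule.span ℝ (contactSet T) ⊔ Submodule.span ℝ {e₀} ≠ ⊤) :
    ∃ T' : X →L[ℝ] H, ‖T'‖ ≤ 1 ∧ (∀ x, T' x = 0 ↔ x ∈ Submodule.span ℝ {e₀}) ∧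
      Submodule.span ℝ (contactSet T) < Submodule.span ℝ (contactSet T') := by
  obtain ⟨ψ, hψ, hψker⟩ := Submodule.exists_le_ker_of_lt_top _ (lt_top_iff_ne_top.2 hspan)
  obtain ⟨hψ1, hψ2⟩ := sup_le_iff.1 hψker
  obtain ⟨v, hv1, hv⟩ : ∃ v : H, ‖v‖ = 1 ∧ ∀ x, inner ℝ (T x) v = 0 := by
    have hne : (LinearMap.range (T : X →ₗ[ℝ] H))ᗮ ≠ ⊥ := fun h =>
      hrange (Submodule.orthogonal_eq_bot_iff.1 h)
    obtain ⟨v, hv, hv0⟩ := Submodule.exists_mem_ne_zero_of_ne_bot hne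
    refine ⟨‖v‖⁻¹ • v, by simp [norm_smul, hv0], fun x => ?_⟩
    have : inner ℝ (T x) v = 0 := hv _ ⟨x, rfl⟩
    rw [real_inner_smul_right, this, mul_zero]
  have hTe : ∀ e ∈ ballExt X, ‖T e‖ ≤ 1 := fun e he => by
    have he1 : ‖e‖ ≤ 1 := by simpa using he.1
    exact (T.le_opNorm e).trans (mul_le_one₀ hT (norm_nonneg _) he1)
  have hFne : {e ∈ ballExt X | ψ e ≠ 0}.Nonempty := by
    by_contra h
    refine hψ (LinearMap.ext_on span_ballExt fun e he => ?_)
    by_contra he'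
    exact h ⟨e, he, he'⟩
  -- Adding `√s ψ v`, with `v` orthogonal to the range, raises `‖T e‖²` by `s ψ(e)²`. The minimal
  -- ratio is the largest `s` keeping a contraction, and its minimizer `e₁` becomes a contact point.
  obtain ⟨e₁, ⟨he₁, hψe₁⟩, hmin⟩ := Set.exists_min_image {e ∈ ballExt X | ψ e ≠ 0}
    (fun e => (1 - ‖T e‖ ^ 2) / ψ e ^ 2) (hfin.subset fun _ h => h.1) hFne
  set s := (1 - ‖T e₁‖ ^ 2) / ψ e₁ ^ 2 with hs
  have hs0 : 0 ≤ s := div_nonneg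
    (sub_nonneg.2 (pow_le_one₀ (norm_nonneg _) (hTe e₁ he₁))) (sq_nonneg _)
  let T' : X →L[ℝ] H := T + (LinearMap.toContinuousLinearMap ψ).smulRight (Real.sqrt s • v)
  have hnorm : ∀ x, ‖T' x‖ ^ 2 = ‖T x‖ ^ 2 + s * ψ x ^ 2 := by
    intro x
    have : T' x = T x + (ψ x * Real.sqrt s) • v := by simp [T', smul_smul]
    rw [this, norm_add_sq_real, real_inner_smul_right, hv, norm_smul, hv1, Real.norm_eq_abs,
      mul_one, sq_abs, mul_pow, Real.sq_sqrt hs0]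
    ring
  have hsub : contactSet T ⊆ contactSet T' := fun c hc => by
    have h0 : ψ c = 0 := hψ1 (Submodule.subset_span hc)
    have := hnorm c
    rw [h0, hc.2] at this
    exact ⟨hc.1, (sq_eq_sq₀ (norm_nonneg _) zero_le_one).1 (by simpa using this)⟩
  have he₁' : e₁ ∈ contactSet T' := by
    refine ⟨he₁, (sq_eq_sq₀ (norm_nonneg _) zero_le_one).1 ?_⟩
    rw [hnorm, hs]
    field_simp
    ring
  refine ⟨T', opNorm_le_one_of_ballExt fun e he => ?_, fun x => ?_, ?_⟩
  · refine (sq_le_sq₀ (norm_nonneg _) zero_le_one).1 ?_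
    rw [hnorm]
    by_cases h : ψ e = 0
    · simpa [h] using hTe e he
    · have h1 := hmin e ⟨he, h⟩
      have hpos : 0 < ψ e ^ 2 := by positivity
      rw [le_div_iff₀ hpos] at h1
      linarith
  · constructor
    · intro h
      have h1 := hnorm x
      rw [h, norm_zero] at h1
      have h2 : ‖T x‖ ^ 2 = 0 := by nlinarith [sq_nonneg ‖T x‖, mul_nonneg hs0 (sq_nonneg (ψ x))]
      exact (hker x).1 (by simpa using h2)
    · intro h
      have h1 := hnorm x
      have h2 : ψ x = 0 := hψ2 h
      rw [(hker x).2 h, h2] at h1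
      simpa using h1
  · refine lt_of_le_of_ne (Submodule.span_mono hsub) fun h => hψe₁ ?_
    have : e₁ ∈ Submodule.span ℝ (contactSet T) := h ▸ Submodule.subset_span he₁'
    exact hψ1 this

theorem exists_contraction_ker_eq_span [FiniteDimensional ℝ H]
    (hdim : Module.finrank ℝ X = Module.finrank ℝ H) (e₀ : X) :
    ∃ T : X →L[ℝ] H, ‖T‖ ≤ 1 ∧ ∀ x, T x = 0 ↔ x ∈ Submodule.span ℝ {e₀} := by
  let J := LinearEquiv.ofFinrankEq X H hdim
  obtain ⟨q, hq⟩ := (Submodule.span ℝ {e₀}).exists_isCompl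
  let P : X →ₗ[ℝ] X := q.subtype ∘ₗ q.projectionOnto _ hq.symm
  let T₀ : X →L[ℝ] H := LinearMap.toContinuousLinearMap (J.toLinearMap ∘ₗ P)
  have hT₀ : ∀ x, T₀ x = 0 ↔ x ∈ Submodule.span ℝ {e₀} := fun x => by
    simp [T₀, P]
  have hpos : 0 < ‖T₀‖ + 1 := by positivity
  refine ⟨(‖T₀‖ + 1)⁻¹ • T₀, ?_, fun x => ?_⟩
  · rw [norm_smul, norm_inv, Real.norm_of_nonneg hpos.le, inv_mul_le_one₀ hpos]
    linarith
  · rw [← hT₀ x]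
    simp [hpos.ne']

/-- If the contractions into a Hilbert space of the same dimension are convex combinations of
contractions preserving the norm of the extreme points, then each extreme point `e₀` has a
functional vanishing at all the extreme points other than `± e₀`. -/
theorem exists_functional_of_ballExt [Nontrivial X] [FiniteDimensional ℝ H]
    (hfin : (ballExt X).Finite)
    (hdim : Module.finrank ℝ X = Module.finrank ℝ H)
    (hH : ∀ T : X →L[ℝ] H, ‖T‖ ≤ 1 → T ∈ convexHull ℝ (extIsometric X H))
    {e₀ : X} (he₀ : e₀ ∈ ballExt X) :
    ∃ φ : X →ₗ[ℝ] ℝ, φ e₀ = 1 ∧ ∀ e ∈ ballExt X, e ≠ e₀ → e ≠ -e₀ → φ e = 0 := by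
  let A : Set (Submodule ℝ X) := {E | ∃ T : X →L[ℝ] H, ‖T‖ ≤ 1 ∧
    (∀ x, T x = 0 ↔ x ∈ Submodule.span ℝ {e₀}) ∧ Submodule.span ℝ (contactSet T) = E}
  obtain ⟨T₀, hT₀, hker₀⟩ := exists_contraction_ker_eq_span hdim e₀
  obtain ⟨_, ⟨T, hT, hker, rfl⟩, hmax⟩ :=
    (wellFounded_gt (α := Submodule ℝ X)).has_min A ⟨_, T₀, hT₀, hker₀, rfl⟩
  refine exists_functional_of_contactSet hfin hH he₀ hT hker ?_
  by_contra hspan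
  -- The dimensions agree and `e₀` is in the kernel, so there is room for an orthogonal direction.
  have hrange : LinearMap.range (T : X →ₗ[ℝ] H) ≠ ⊤ := fun h => by
    have hinj := (LinearMap.injective_iff_surjective_of_finrank_eq_finrank hdim).2
      (LinearMap.range_eq_top.1 h)
    have h0 : e₀ = 0 := hinj (by
      simpa using (hker e₀).2 (Submodule.mem_span_singleton_self e₀))
    simpa [h0] using norm_eq_one_of_mem_ballExt he₀
  obtain ⟨T', hT', hker', hlt⟩ := exists_contraction_contactSet_lt hfin hT hker hrange hspan
  exact hmax _ ⟨T', hT', hker', rfl⟩ hlt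

end Hilbert

/-! ### The isometry with `ℓ₁ⁿ`. -/

section Isometry

variable {X : Type*} [NormedAddCommGroup X] [NormedSpace ℝ X] [FiniteDimensional ℝ X]

/-- A space whose extreme points admit separating functionals is isometric to `ℓ₁ⁿ`. -/
theorem nonempty_linearIsometryEquiv_l1 [Nontrivial X]
    (h : ∀ e₀ ∈ ballExt X, ∃ φ : X →ₗ[ℝ] ℝ, φ e₀ = 1 ∧
      ∀ e ∈ ballExt X, e ≠ e₀ → e ≠ -e₀ → φ e = 0)
    {n : ℕ} (hn : Module.finrank ℝ X = n) :
    Nonempty (X ≃ₗᵢ[ℝ] PiLp 1 (fun _ : Fin n => ℝ)) := by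
  obtain ⟨f, hf, hfspan, hind⟩ := Submodule.exists_fun_fin_finrank_span_eq ℝ (ballExt X)
  have hcard : Module.finrank ℝ (Submodule.span ℝ (ballExt X)) = n := by
    rw [span_ballExt, finrank_top, hn]
  revert f
  rw [hcard]
  intro f hf hfspan hind
  rw [span_ballExt] at hfspan
  let b : Module.Basis (Fin n) ℝ X := Module.Basis.mk hind hfspan.ge
  have hb : ∀ i, b i = f i := fun i => by simp [b]
  have hbne : ∀ i j, j ≠ i → f j ≠ f i ∧ f j ≠ -f i := by
    intro i j hij
    refine ⟨fun h => hij (hind.injective h), fun h => ?_⟩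
    have := congrArg (fun x => b.repr x i) h
    simp [← hb, hij] at this
  have hcoord : ∀ i, ∀ e ∈ ballExt X, e ≠ f i → e ≠ -f i → b.repr e i = 0 := by
    intro i e he h1 h2
    obtain ⟨φ, hφ, hφ0⟩ := h (f i) (hf i)
    -- The basis consists of extreme points, so `φ` takes the values of the `i`-th coordinate on it.
    have : φ = b.coord i := b.ext fun j => by
      rcases eq_or_ne j i with rfl | hij
      · rw [hb, hφ, ← hb]; simp
      · rw [hb, hφ0 (f j) (hf j) (hbne i j hij).1 (hbne i j hij).2, ← hb]
        simp [hij]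
    rw [← b.coord_apply, ← this, hφ0 e he h1 h2]
  have hext : ∀ e ∈ ballExt X, ∃ i, e = f i ∨ e = -f i := by
    intro e he
    by_contra! hne
    have : e = 0 := b.ext_elem fun i => by simp [hcoord i e he (hne i).1 (hne i).2]
    simpa [this] using norm_eq_one_of_mem_ballExt he
  let L : X ≃ₗ[ℝ] PiLp 1 (fun _ : Fin n => ℝ) :=
    b.equivFun ≪≫ₗ (WithLp.linearEquiv 1 ℝ (Fin n → ℝ)).symm
  have hL : ∀ x, ‖L x‖ = ∑ i, |b.repr x i| := fun x => by
    simp [L, PiLp.norm_eq_of_L1]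
  let Lc : X →L[ℝ] PiLp 1 (fun _ : Fin n => ℝ) := LinearMap.toContinuousLinearMap L.toLinearMap
  have hLc : ‖Lc‖ ≤ 1 := by
    refine opNorm_le_one_of_ballExt fun e he => ?_
    change ‖L e‖ ≤ 1
    obtain ⟨i, rfl | rfl⟩ := hext e he <;>
      simp [hL, ← hb, Finsupp.single_apply, apply_ite abs]
  refine ⟨⟨L, fun x => le_antisymm ?_ ?_⟩⟩
  · have := Lc.le_of_opNorm_le hLc x
    rwa [one_mul] at this
  · rw [hL]
    conv_lhs => rw [← b.sum_repr x]
    refine (norm_sum_le _ _).trans (Finset.sum_le_sum fun i _ => ?_)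
    rw [norm_smul, hb, norm_eq_one_of_mem_ballExt (hf i), mul_one, Real.norm_eq_abs]

end Isometry

theorem proposition4p12 (X : Type u) [NormedAddCommGroup X] [NormedSpace ℝ X]
    [FiniteDimensional ℝ X] (n : ℕ) (hn : Module.finrank ℝ X = n)
    (hX : ∀ (Y : Type u) [NormedAddCommGroup Y] [NormedSpace ℝ Y] [CompleteSpace Y]
      [Nontrivial Y],
      Metric.closedBall (0 : X →L[ℝ] Y) 1 = closure (convexHull ℝ (Gen ℝ X Y))) :
    Nonempty (X ≃ₗᵢ[ℝ] PiLp 1 (fun _ : Fin n => ℝ)) := by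
  -- In the zero space 0 is an extreme point of the ball, so the norm-one property fails.
  rcases subsingleton_or_nontrivial X with hsub | hnt
  · have h0 : n = 0 := by rw [← hn, Module.finrank_zero_of_subsingleton]
    subst h0
    exact ⟨⟨0, fun x => by simp [Subsingleton.elim x 0]⟩⟩
  have hpos : 0 < n := hn ▸ Module.finrank_pos
  have : Nonempty (Fin n) := ⟨⟨0, hpos⟩⟩
  have hfin : (ballExt X).Finite := by
    -- `EuclideanSpace ℝ PUnit` is a copy of `ℝ` in the universe of `X`; its unit sphere has two
    -- points.
    refine finite_ballExt_of_line (Y := EuclideanSpace ℝ PUnit.{u + 1}) ?_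
      fun T hT => mem_convexHull_extIsometric (hX _) hT
    refine Set.Finite.subset
      (Set.toFinite {EuclideanSpace.single PUnit.unit 1, EuclideanSpace.single PUnit.unit (-1)})
      fun y hy => ?_
    have h1 : |y PUnit.unit| = 1 := by
      simpa [EuclideanSpace.norm_eq, Real.sqrt_sq_eq_abs] using hy
    rcases eq_or_eq_neg_of_abs_eq h1 with h | h
    · left; ext i; simp [h]
    · right; ext i; simp [h]
  refine nonempty_linearIsometryEquiv_l1 (fun e₀ he₀ => ?_) hn
  exact exists_functional_of_ballExt (H := EuclideanSpace ℝ (ULift.{u} (Fin n))) hfin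
    (by simp [hn]) (fun T hT => mem_convexHull_extIsometric (hX _) hT) he₀
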